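/- A $C^\infty$-ring is a product preserving functor to sets from the category whose objects are the spaces $\mathbb R^n$ ($n\ge 0$) and whose morphisms are the smooth maps; equivalently, it is a set $A$ with an operation $A^n\to A$ for every smooth function $\mathbb R^n\to\mathbb R$, $n\ge 0$, such that the operations respect coordinate projections and composition of smooth maps. It has an underlying commutative $\mathbb R$-algebra, and its ideals are the ideals of this algebra; for every ideal $I\le A$ the quotient $A/I$ is again a $C^\infty$-ring. A morphism of $C^\infty$-rings is a map that commutes with all the operations. For a $C^\infty$-ring $B$ and $b\in B$, let $B\{b^{-1}\}$ be the $C^\infty$-ring obtained from $B$ by universally inverting $b$ in the category of $C^\infty$-rings. For an ideal $I\le A$ put $$\sqrt{I}:=\{f\in A \mid \exists k\in\mathbb Z_{>0}:\ f^k\in I\},\qquad \sqrt[\infty]{I}:=\{f\in A \mid (A/I)\{f^{-1}\}\cong\{0\}\},$$ the nilradical and the $\infty$-radical of $I$. **Proposition.** Let $\phi\colon A_1\to A_2$ be any morphism of $C^\infty$-rings (not necessarily finitely generated). Then $$\phi^{-1}\bigl(\sqrt{0}\bigr)=\sqrt{\ker\phi}\qquad\text{and}\qquad \phi^{-1}\bigl(\sqrt[\infty]{0}\bigr)=\sqrt[\infty]{\ker\phi}.$$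 -/

import Mathlib

open scoped ContDiff

universe u v w

/-- The smooth real functions on `ℝⁿ`, as an algebra of functions. -/
def smoothSubalgebra (n : ℕ) : Subalgebra ℝ ((Fin n → ℝ) → ℝ) where
  carrier := {f | ContDiff ℝ ∞ f}
  mul_mem' {f g} (hf : ContDiff ℝ ∞ f) (hg : ContDiff ℝ ∞ g) := ContDiff.mul hf hg
  add_mem' {f g} (hf : ContDiff ℝ ∞ f) (hg : ContDiff ℝ ∞ g) := ContDiff.add hf hg
  algebraMap_mem' r := (contDiff_const : ContDiff ℝ ∞ fun _ : Fin n → ℝ => r)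

/-- The ring `C^∞(ℝⁿ)` of smooth real functions on `ℝⁿ`. -/
abbrev SmoothFn (n : ℕ) : Type := smoothSubalgebra n

namespace SmoothFn

theorem contDiff {n : ℕ} (f : SmoothFn n) : ContDiff ℝ ∞ f.1 := f.2

/-- The `i`-th coordinate function on `ℝⁿ`. -/
def proj {n : ℕ} (i : Fin n) : SmoothFn n :=
  ⟨fun x => x i, (contDiff_apply ℝ ℝ i : ContDiff ℝ ∞ fun x : Fin n → ℝ => x i)⟩

/-- The composite of `g = (g₁, …, gₘ) : ℝⁿ → ℝᵐ` with `f : ℝᵐ → ℝ`. -/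
def comp {m n : ℕ} (f : SmoothFn m) (g : Fin m → SmoothFn n) : SmoothFn n :=
  ⟨fun x => f.1 (fun i => (g i).1 x),
    ContDiff.comp f.contDiff (contDiff_pi.2 fun i => (g i).contDiff)⟩

/-- Averages of a smooth map along segments depend smoothly on the end points. -/
theorem exists_segment_average {E W : Type} [NormedAddCommGroup E] [NormedSpace ℝ E]
    [NormedAddCommGroup W] [NormedSpace ℝ W] {D : E → W} (hD : ContDiff ℝ ∞ D) :
    ∃ G : E × E → W, ContDiff ℝ ∞ G ∧
      ∀ x y, G (x, y) = ∫ t in (0 : ℝ)..1, D (y + t • (x - y)) := by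
  let χ : ContDiffBump (0 : ℝ) := ⟨1, 2, by norm_num, by norm_num⟩
  let F : E × E → ℝ → W := fun p t => χ t • D (p.2 - t • (p.1 - p.2))
  let u : ℝ → ℝ := Set.indicator (Set.Icc 0 1) 1
  have hF : ContDiff ℝ ∞ (fun q : (E × E) × ℝ => F q.1 q.2) := by
    have h2 : ContDiff ℝ ∞ χ := χ.contDiff
    exact (h2.comp contDiff_snd).smul (hD.comp (by fun_prop))
  have hu : MeasureTheory.LocallyIntegrable u := by
    apply MeasureTheory.Integrable.locallyIntegrable
    exact (MeasureTheory.integrable_indicator_iff measurableSet_Icc).2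
      (MeasureTheory.integrableOn_const (by simp))
  have key := MeasureTheory.contDiffOn_convolution_right_with_param (𝕜 := ℝ)
    (μ := MeasureTheory.volume)
    (f := u) (g := F) (n := (⊤ : ℕ∞)) (s := Set.univ) (k := Metric.closedBall 0 2)
    (ContinuousLinearMap.lsmul ℝ ℝ) isOpen_univ (isCompact_closedBall 0 2)
    (fun p t _ ht => by
      have h0 : χ t = 0 := χ.zero_of_le_dist (le_of_lt (not_le.1 ht))
      simp only [F, h0, zero_smul]) hu hF.contDiffOn
  rw [Set.univ_prod_univ, contDiffOn_univ] at key
  refine ⟨_, key.comp (contDiff_id.prodMk contDiff_const : ContDiff ℝ ∞ fun p => (p, (0 : ℝ))),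
    fun x y => ?_⟩
  rw [intervalIntegral.integral_of_le zero_le_one, ← MeasureTheory.integral_Icc_eq_integral_Ioc,
    ← MeasureTheory.integral_indicator measurableSet_Icc]
  refine MeasureTheory.integral_congr_ae (Filter.Eventually.of_forall fun t => ?_)
  change u t • (χ (0 - t) • D (y - (0 - t) • (x - y))) = _
  by_cases ht : t ∈ Set.Icc (0 : ℝ) 1
  · have h1 : χ (0 - t) = 1 := χ.one_of_mem_closedBall (by
      rw [Metric.mem_closedBall, Real.dist_eq, abs_le]
      change -1 ≤ _ ∧ _ ≤ 1
      constructor <;> linarith [ht.1, ht.2])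
    have h2 : u t = 1 := Set.indicator_of_mem ht 1
    rw [h1, h2, one_smul, one_smul, Set.indicator_of_mem ht, zero_sub, neg_smul, sub_neg_eq_add]
  · have h2 : u t = 0 := Set.indicator_of_notMem ht 1
    rw [h2, zero_smul, Set.indicator_of_notMem ht]

/-- Hadamard's lemma. -/
theorem hadamard {n : ℕ} (f : SmoothFn n) :
    ∃ g : Fin n → SmoothFn (n + n), ∀ x y : Fin n → ℝ,
      f.1 x - f.1 y = ∑ i, (x i - y i) * (g i).1 (Fin.append x y) := by
  obtain ⟨G, hG, hG2⟩ := exists_segment_average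
    (f.contDiff.fderiv_right (m := ∞) (n := ∞) (by simp))
  have hc : Continuous (fderiv ℝ f.1) := f.contDiff.continuous_fderiv (by simp)
  have hG3 (x y : Fin n → ℝ) : f.1 x - f.1 y = G (x, y) (x - y) := by
    have hi : Continuous fun t : ℝ => fderiv ℝ f.1 (y + t • (x - y)) := by fun_prop
    rw [hG2, ContinuousLinearMap.intervalIntegral_apply (hi.intervalIntegrable _ _)]
    have hd (t : ℝ) : HasDerivAt (fun t : ℝ => f.1 (y + t • (x - y)))
        (fderiv ℝ f.1 (y + t • (x - y)) (x - y)) t := by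
      have h1 := (f.contDiff.differentiable (by simp) (y + t • (x - y))).hasFDerivAt
      have h2 : HasDerivAt (fun t : ℝ => y + t • (x - y)) (x - y) t := by
        simpa using ((hasDerivAt_id t).smul_const (x - y)).const_add y
      exact h1.comp_hasDerivAt t h2
    rw [intervalIntegral.integral_eq_sub_of_hasDerivAt (fun t _ => hd t)
      ((hi.clm_apply continuous_const).intervalIntegrable _ _)]
    simp
  refine ⟨fun i => ⟨fun z => G (fun j => z (Fin.castAdd n j), fun j => z (Fin.natAdd n j))
    (Pi.single i 1), ?_⟩, fun x y => ?_⟩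
  · exact (hG.comp (by fun_prop)).clm_apply contDiff_const
  · rw [hG3]
    simp only [Fin.append_left, Fin.append_right]
    conv_lhs => rw [← Finset.univ_sum_single (x - y), map_sum]
    refine Finset.sum_congr rfl fun i _ => ?_
    have h : (Pi.single i ((x - y) i) : Fin n → ℝ) = (x i - y i) • Pi.single i (1 : ℝ) := by
      rw [← Pi.single_smul]; simp
    rw [h, map_smul, smul_eq_mul]

end SmoothFn

/-- Operations `A^n → A` indexed by the smooth functions `ℝⁿ → ℝ`, for all `n ≥ 0`, that respect
coordinate projections and composition of smooth maps. Equivalently, a product preserving functor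
to sets, with value `A` on `ℝ`, from the category of the spaces `ℝⁿ` and smooth maps. -/
class SmoothOps (A : Type u) where
  op : {n : ℕ} → SmoothFn n → (Fin n → A) → A
  op_proj : ∀ {n : ℕ} (i : Fin n) (a : Fin n → A), op (SmoothFn.proj i) a = a i
  op_comp : ∀ {m n : ℕ} (f : SmoothFn m) (g : Fin m → SmoothFn n) (a : Fin n → A),
    op (f.comp g) a = op f (fun i => op (g i) a)

namespace SmoothOps

variable {A : Type u} [SmoothOps A]

/-- The addition induced by the smooth function `(x, y) ↦ x + y`. -/
def add (a b : A) : A := op (SmoothFn.proj 0 + SmoothFn.proj 1 : SmoothFn 2) ![a, b]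

/-- The multiplication induced by the smooth function `(x, y) ↦ x * y`. -/
def mul (a b : A) : A := op (SmoothFn.proj 0 * SmoothFn.proj 1 : SmoothFn 2) ![a, b]

/-- The negation induced by the smooth function `x ↦ -x`. -/
def neg (a : A) : A := op (-SmoothFn.proj 0 : SmoothFn 1) ![a]

/-- The element of `A` given by a real constant, a smooth function on `ℝ⁰`. -/
def const (A : Type u) [SmoothOps A] (r : ℝ) : A := op (algebraMap ℝ (SmoothFn 0) r) ![]

theorem add_op {n : ℕ} (f g : SmoothFn n) (v : Fin n → A) :
    add (op f v) (op g v) = op (f + g) v := by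
  have h : f + g = (SmoothFn.proj 0 + SmoothFn.proj 1 : SmoothFn 2).comp ![f, g] := rfl
  rw [h, op_comp, add]
  congr 1
  funext i
  fin_cases i <;> rfl

theorem mul_op {n : ℕ} (f g : SmoothFn n) (v : Fin n → A) :
    mul (op f v) (op g v) = op (f * g) v := by
  have h : f * g = (SmoothFn.proj 0 * SmoothFn.proj 1 : SmoothFn 2).comp ![f, g] := rfl
  rw [h, op_comp, mul]
  congr 1
  funext i
  fin_cases i <;> rfl

theorem neg_op {n : ℕ} (f : SmoothFn n) (v : Fin n → A) :
    neg (op f v) = op (-f) v := by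
  have h : -f = (-SmoothFn.proj 0 : SmoothFn 1).comp ![f] := rfl
  rw [h, op_comp, neg]
  congr 1
  funext i
  fin_cases i; rfl

theorem const_op {n : ℕ} (r : ℝ) (v : Fin n → A) :
    const A r = op (algebraMap ℝ (SmoothFn n) r) v := by
  have h : algebraMap ℝ (SmoothFn n) r = (algebraMap ℝ (SmoothFn 0) r).comp ![] := rfl
  rw [h, op_comp, const]
  congr 1
  funext i
  exact i.elim0

/-- The commutative ring underlying a family of smooth operations. -/
abbrev commRing (A : Type u) [SmoothOps A] : CommRing A :=
  have key (a b c : A) : ∃ f g h : SmoothFn 3,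
      a = op f ![a, b, c] ∧ b = op g ![a, b, c] ∧ c = op h ![a, b, c] :=
    ⟨SmoothFn.proj 0, SmoothFn.proj 1, SmoothFn.proj 2, by simp [op_proj], by simp [op_proj],
      by simp [op_proj]⟩
  { add := add
    mul := mul
    neg := neg
    zero := const A 0
    one := const A 1
    nsmul := @nsmulRec A ⟨const A 0⟩ ⟨add⟩
    zsmul := @zsmulRec A ⟨const A 0⟩ ⟨add⟩ ⟨neg⟩
      (@nsmulRec A ⟨const A 0⟩ ⟨add⟩)
    npow := @npowRec A ⟨const A 1⟩ ⟨mul⟩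
    natCast := @Nat.unaryCast A ⟨const A 1⟩ ⟨const A 0⟩ ⟨add⟩
    add_assoc := fun a b c => by
      change add (add a b) c = add a (add b c)
      obtain ⟨f, g, h, hf, hg, hh⟩ := key a b c
      generalize ![a, b, c] = v at *
      subst hf hg hh
      simp only [add_op, add_assoc]
    zero_add := fun a => by
      change add (const A 0) a = a
      obtain ⟨f, g, h, hf, hg, hh⟩ := key a a a
      generalize ![a, a, a] = v at *
      rw [hf, const_op 0 v, add_op, map_zero, zero_add]
    add_zero := fun a => by
      change add a (const A 0) = a
      obtain ⟨f, g, h, hf, hg, hh⟩ := key a a a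
      generalize ![a, a, a] = v at *
      rw [hf, const_op 0 v, add_op, map_zero, add_zero]
    add_comm := fun a b => by
      change add a b = add b a
      obtain ⟨f, g, h, hf, hg, hh⟩ := key a b a
      generalize ![a, b, a] = v at *
      rw [hf, hg, add_op, add_op, add_comm]
    neg_add_cancel := fun a => by
      change add (neg a) a = const A 0
      obtain ⟨f, g, h, hf, hg, hh⟩ := key a a a
      generalize ![a, a, a] = v at *
      rw [hf, neg_op, add_op, const_op 0 v, map_zero, neg_add_cancel]
    mul_assoc := fun a b c => by
      change mul (mul a b) c = mul a (mul b c)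
      obtain ⟨f, g, h, hf, hg, hh⟩ := key a b c
      generalize ![a, b, c] = v at *
      subst hf hg hh
      simp only [mul_op, mul_assoc]
    one_mul := fun a => by
      change mul (const A 1) a = a
      obtain ⟨f, g, h, hf, hg, hh⟩ := key a a a
      generalize ![a, a, a] = v at *
      rw [hf, const_op 1 v, mul_op, map_one, one_mul]
    mul_one := fun a => by
      change mul a (const A 1) = a
      obtain ⟨f, g, h, hf, hg, hh⟩ := key a a a
      generalize ![a, a, a] = v at *
      rw [hf, const_op 1 v, mul_op, map_one, mul_one]
    zero_mul := fun a => by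
      change mul (const A 0) a = const A 0
      obtain ⟨f, g, h, hf, hg, hh⟩ := key a a a
      generalize ![a, a, a] = v at *
      rw [hf, const_op 0 v, mul_op, map_zero, zero_mul]
    mul_zero := fun a => by
      change mul a (const A 0) = const A 0
      obtain ⟨f, g, h, hf, hg, hh⟩ := key a a a
      generalize ![a, a, a] = v at *
      rw [hf, const_op 0 v, mul_op, map_zero, mul_zero]
    mul_comm := fun a b => by
      change mul a b = mul b a
      obtain ⟨f, g, h, hf, hg, hh⟩ := key a b a
      generalize ![a, b, a] = v at *
      rw [hf, hg, mul_op, mul_op, mul_comm]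
    left_distrib := fun a b c => by
      change mul a (add b c) = add (mul a b) (mul a c)
      obtain ⟨f, g, h, hf, hg, hh⟩ := key a b c
      generalize ![a, b, c] = v at *
      subst hf hg hh
      simp only [mul_op, add_op, mul_add]
    right_distrib := fun a b c => by
      change mul (add a b) c = add (mul a c) (mul b c)
      obtain ⟨f, g, h, hf, hg, hh⟩ := key a b c
      generalize ![a, b, c] = v at *
      subst hf hg hh
      simp only [mul_op, add_op, add_mul] }

end SmoothOps

/-- A `C^∞`-ring: a set with smooth operations. The ring structure is the one that the operations
induce (it is determined by its addition and multiplication); it is a separate argument only so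
that rings such as quotients keep their usual ring structure. -/
class CInftyRing (A : Type u) [CommRing A] extends SmoothOps A where
  add_eq : ∀ a b : A, a + b = SmoothOps.add a b
  mul_eq : ∀ a b : A, a * b = SmoothOps.mul a b

namespace CInftyRing

open SmoothOps

/-- Every set with smooth operations is a `C^∞`-ring for the ring structure that they induce. -/
@[reducible] def ofSmoothOps (A : Type u) [SmoothOps A] :
    @CInftyRing A (SmoothOps.commRing A) :=
  letI := SmoothOps.commRing A
  { ‹SmoothOps A› with
    add_eq := fun _ _ => rfl
    mul_eq := fun _ _ => rfl }

/-- The ring structure of a `C^∞`-ring is the one induced by its operations. -/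
theorem eq_commRing (A : Type u) [inst : CommRing A] [CInftyRing A] :
    inst = SmoothOps.commRing A := by
  refine CommRing.ext ?_ ?_
  · funext a b; exact add_eq a b
  · funext a b; exact mul_eq a b

variable {A : Type u} [CommRing A] [CInftyRing A]

theorem const_zero : SmoothOps.const A 0 = 0 := by
  have h : SmoothOps.const A 0 + SmoothOps.const A 0 = SmoothOps.const A 0 := by
    rw [add_eq, SmoothOps.const, SmoothOps.add_op, ← map_add, add_zero]
  simpa using h

theorem const_one : SmoothOps.const A 1 = 1 := by
  have h : SmoothOps.const A 1 * 1 = 1 := by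
    have h1 : (1 : A) = op (SmoothFn.proj 0 : SmoothFn 1) ![1] := by simp [op_proj]
    conv_lhs => rw [mul_eq, const_op 1 ![(1 : A)]]
    conv_lhs => arg 2; rw [h1]
    rw [mul_op, map_one, one_mul, ← h1]
  simpa using h

/-- Evaluation of smooth functions at a point of `Aⁿ`. -/
def evalHom {n : ℕ} (v : Fin n → A) : SmoothFn n →+* A where
  toFun f := op f v
  map_zero' := by rw [← map_zero (algebraMap ℝ (SmoothFn n)), ← const_op, const_zero]
  map_one' := by rw [← map_one (algebraMap ℝ (SmoothFn n)), ← const_op, const_one]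
  map_add' f g := by rw [add_eq (A := A), add_op]
  map_mul' f g := by rw [mul_eq (A := A), mul_op]

theorem op_sub_op_mem (I : Ideal A) {n : ℕ} (f : SmoothFn n) (a b : Fin n → A)
    (h : ∀ i, a i - b i ∈ I) : op f a - op f b ∈ I := by
  obtain ⟨g, hg⟩ := f.hadamard
  have e : f.comp (fun i => SmoothFn.proj (Fin.castAdd n i)) -
      f.comp (fun i => SmoothFn.proj (Fin.natAdd n i)) =
      ∑ i, (SmoothFn.proj (Fin.castAdd n i) - SmoothFn.proj (Fin.natAdd n i)) * g i := by
    ext z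
    have hz : Fin.append (fun i => z (Fin.castAdd n i)) (fun i => z (Fin.natAdd n i)) = z :=
      Fin.append_castAdd_natAdd
    have h := hg (fun i => z (Fin.castAdd n i)) (fun i => z (Fin.natAdd n i))
    rw [hz] at h
    rw [AddSubgroupClass.coe_sub, AddSubmonoidClass.coe_finsetSum, Pi.sub_apply,
      Finset.sum_apply]
    exact h
  have e2 := congrArg (evalHom (Fin.append a b)) e
  rw [map_sub, map_sum] at e2
  have e3 : op f a - op f b = ∑ i, (a i - b i) * op (g i) (Fin.append a b) := by
    simp only [map_mul, map_sub] at e2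
    simpa only [evalHom, RingHom.coe_mk, MonoidHom.coe_mk, OneHom.coe_mk, op_comp, op_proj,
      Fin.append_left, Fin.append_right] using e2
  rw [e3]
  exact I.sum_mem fun i _ => I.mul_mem_right _ (h i)

/-- The quotient of a `C^∞`-ring by an ideal of the underlying ring, with the operations induced
on representatives. -/
noncomputable instance quotient (I : Ideal A) : CInftyRing (A ⧸ I) where
  op f a := Ideal.Quotient.mk I (op f fun i => (a i).out)
  op_proj i a := by simp [op_proj]
  op_comp f g a := by
    rw [op_comp, Ideal.Quotient.eq]
    refine op_sub_op_mem I f (fun i => op (g i) fun j => (a j).out) _ fun i => ?_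
    rw [← Ideal.Quotient.eq]
    simp
  add_eq a b := by
    have h : (fun i => (![a, b] i).out) = ![a.out, b.out] := by
      funext i; fin_cases i <;> rfl
    change _ = Ideal.Quotient.mk I (op _ fun i => (![a, b] i).out)
    rw [h]
    change _ = Ideal.Quotient.mk I (SmoothOps.add _ _)
    rw [← CInftyRing.add_eq]
    simp
  mul_eq a b := by
    have h : (fun i => (![a, b] i).out) = ![a.out, b.out] := by
      funext i; fin_cases i <;> rfl
    change _ = Ideal.Quotient.mk I (op _ fun i => (![a, b] i).out)
    rw [h]
    change _ = Ideal.Quotient.mk I (SmoothOps.mul _ _)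
    rw [← CInftyRing.mul_eq]
    simp

theorem quotient_op_mk (I : Ideal A) {n : ℕ} (f : SmoothFn n) (a : Fin n → A) :
    op f (fun i => Ideal.Quotient.mk I (a i)) = Ideal.Quotient.mk I (op f a) := by
  change Ideal.Quotient.mk I _ = _
  rw [Ideal.Quotient.eq]
  refine op_sub_op_mem I f _ _ fun i => ?_
  rw [← Ideal.Quotient.eq]
  simp

end CInftyRing

/-- A morphism of `C^∞`-rings: a map that commutes with all smooth operations. -/
structure CInftyHom (A : Type u) (B : Type v) [SmoothOps A] [SmoothOps B] where
  toFun : A → B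
  map_op : ∀ {n : ℕ} (f : SmoothFn n) (a : Fin n → A),
    toFun (SmoothOps.op f a) = SmoothOps.op f (fun i => toFun (a i))

namespace CInftyHom

variable {A : Type u} {B : Type v}

/-- The ring homomorphism underlying a morphism of `C^∞`-rings. -/
def toRingHom [CommRing A] [CInftyRing A] [CommRing B] [CInftyRing B] (φ : CInftyHom A B) :
    A →+* B where
  toFun := φ.toFun
  map_zero' := by
    rw [← CInftyRing.const_zero (A := A), ← CInftyRing.const_zero (A := B), SmoothOps.const,
      φ.map_op, SmoothOps.const]
    congr 1; funext i; exact i.elim0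
  map_one' := by
    rw [← CInftyRing.const_one (A := A), ← CInftyRing.const_one (A := B), SmoothOps.const,
      φ.map_op, SmoothOps.const]
    congr 1; funext i; exact i.elim0
  map_add' a b := by
    rw [CInftyRing.add_eq, CInftyRing.add_eq, SmoothOps.add, φ.map_op, SmoothOps.add]
    congr 1; funext i; fin_cases i <;> rfl
  map_mul' a b := by
    rw [CInftyRing.mul_eq, CInftyRing.mul_eq, SmoothOps.mul, φ.map_op, SmoothOps.mul]
    congr 1; funext i; fin_cases i <;> rfl

end CInftyHom

namespace CInftyRing

/-- Formal expressions built by smooth operations from the elements of `A` and one further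
symbol `inv`. -/
inductive PreLoc (A : Type u) : Type u
  | of : A → PreLoc A
  | inv : PreLoc A
  | op : {n : ℕ} → SmoothFn n → (Fin n → PreLoc A) → PreLoc A

/-- The smallest congruence on formal expressions for which the quotient has smooth operations,
the map from `A` is a morphism, and `inv` is an inverse of `b`. -/
inductive PreLoc.Rel {A : Type u} [CommRing A] [CInftyRing A] (b : A) :
    PreLoc A → PreLoc A → Prop
  | refl (x) : Rel b x x
  | symm {x y} : Rel b x y → Rel b y x
  | trans {x y z} : Rel b x y → Rel b y z → Rel b x z
  | op_congr {n : ℕ} (f : SmoothFn n) {x y : Fin n → PreLoc A} :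
      (∀ i, Rel b (x i) (y i)) → Rel b (.op f x) (.op f y)
  | op_proj {n : ℕ} (i : Fin n) (x : Fin n → PreLoc A) : Rel b (.op (SmoothFn.proj i) x) (x i)
  | op_comp {m n : ℕ} (f : SmoothFn m) (g : Fin m → SmoothFn n) (x : Fin n → PreLoc A) :
      Rel b (.op (f.comp g) x) (.op f fun i => .op (g i) x)
  | of_op {n : ℕ} (f : SmoothFn n) (a : Fin n → A) :
      Rel b (.of (SmoothOps.op f a)) (.op f fun i => .of (a i))
  | mul_inv : Rel b (.op (SmoothFn.proj 0 * SmoothFn.proj 1 : SmoothFn 2) ![.of b, .inv]) (.of 1)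

variable {A : Type u} [CommRing A] [CInftyRing A]

/-- The congruence as a setoid. -/
def PreLoc.setoid (b : A) : Setoid (PreLoc A) := ⟨Rel b, .refl, .symm, .trans⟩

/-- `A{b⁻¹}`: the universal `C^∞`-ring under `A` in which `b` is invertible. -/
def Loc (b : A) : Type u := Quotient (PreLoc.setoid b)

namespace Loc

/-- The element of `A{b⁻¹}` given by a formal expression. -/
def mk (b : A) (x : PreLoc A) : Loc b := Quotient.mk (PreLoc.setoid b) x

noncomputable instance (b : A) : SmoothOps (Loc b) where
  op f x := Quotient.mk (PreLoc.setoid b) (.op f fun i => (x i).out)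
  op_proj i x := by
    refine (Quotient.sound (s := PreLoc.setoid b) (PreLoc.Rel.op_proj i _)).trans ?_
    exact Quotient.out_eq _
  op_comp f g x := by
    refine Quotient.sound (s := PreLoc.setoid b) ((PreLoc.Rel.op_comp f g _).trans ?_)
    exact .op_congr f fun i => .symm (Quotient.mk_out (s := PreLoc.setoid b) _)

noncomputable instance (b : A) : CommRing (Loc b) := SmoothOps.commRing (Loc b)

noncomputable instance (b : A) : CInftyRing (Loc b) where
  add_eq _ _ := rfl
  mul_eq _ _ := rfl

theorem op_mk (b : A) {n : ℕ} (f : SmoothFn n) (x : Fin n → PreLoc A) :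
    SmoothOps.op f (fun i => mk b (x i)) =
      mk b (.op f x) :=
  Quotient.sound (s := PreLoc.setoid b)
    (.op_congr f fun _ => Quotient.mk_out (s := PreLoc.setoid b) _)

/-- The canonical morphism `A → A{b⁻¹}`. -/
def of (b : A) : CInftyHom A (Loc b) where
  toFun a := mk b (.of a)
  map_op f a := by
    rw [op_mk]
    exact Quotient.sound (s := PreLoc.setoid b) (.of_op f a)

/-- The inverse of `b` in `A{b⁻¹}`. -/
def inv (b : A) : Loc b := mk b .inv

theorem mul_inv_eq_one (b : A) :
    (of b).toFun b * inv b = 1 := by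
  have h : (1 : Loc b) = (of b).toFun 1 := (map_one (of b).toRingHom).symm
  rw [CInftyRing.mul_eq, SmoothOps.mul, h]
  have h2 : mk b (.op (SmoothFn.proj 0 * SmoothFn.proj 1 : SmoothFn 2) ![.of b, .inv]) =
      mk b (.of 1) := Quotient.sound (s := PreLoc.setoid b) PreLoc.Rel.mul_inv
  refine Eq.trans ?_ h2
  rw [← op_mk]
  congr 1; funext i; fin_cases i <;> rfl

theorem isUnit_of (b : A) : IsUnit ((of b).toFun b) :=
  IsUnit.of_mul_eq_one _ (mul_inv_eq_one b)

/-- The universal property of `A{b⁻¹}`. -/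
theorem existsUnique_lift (b : A) {C : Type w} [CommRing C] [CInftyRing C] (φ : CInftyHom A C)
    (h : IsUnit (φ.toFun b)) :
    ∃! ψ : CInftyHom (Loc b) C, ∀ a, ψ.toFun ((of b).toFun a) = φ.toFun a := by
  obtain ⟨c, hc⟩ := h.exists_right_inv
  let F : PreLoc A → C := fun x => PreLoc.rec (motive := fun _ => C) φ.toFun c
    (fun f _ ih => SmoothOps.op f ih) x
  have hF : ∀ x y, PreLoc.Rel b x y → F x = F y := by
    intro x y hxy
    induction hxy with
    | refl => rfl
    | symm _ ih => exact ih.symm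
    | trans _ _ ih1 ih2 => exact ih1.trans ih2
    | op_congr f _ ih => exact congrArg (SmoothOps.op f) (funext ih)
    | op_proj i x => exact SmoothOps.op_proj i fun i => F (x i)
    | op_comp f g x => exact SmoothOps.op_comp f g fun i => F (x i)
    | of_op f a => exact φ.map_op f a
    | mul_inv =>
      have h1 : F (.of 1) = 1 := map_one φ.toRingHom
      rw [h1, ← hc, mul_eq (A := C), SmoothOps.mul]
      change SmoothOps.op _ (fun i => F (![PreLoc.of b, PreLoc.inv] i)) = _
      congr 1; funext i; fin_cases i <;> rfl
  refine ⟨⟨Quotient.lift (s := PreLoc.setoid b) F hF, fun f a => ?_⟩, fun _ => rfl, ?_⟩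
  · change SmoothOps.op f (fun i => F (a i).out) = _
    congr 1; funext i
    conv_rhs => rw [← Quotient.out_eq (a i)]
    rfl
  · intro ψ hψ
    have hi : ψ.toFun (inv b) = c := by
      have h2 : (of b).toFun b * inv b = 1 :=
        mul_inv_eq_one b
      have h3 := congrArg ψ.toRingHom h2
      rw [map_mul, map_one] at h3
      have h4 : φ.toFun b * ψ.toFun (inv b) = 1 := by
        rw [← hψ b]; exact h3
      exact h.mul_left_cancel (h4.trans hc.symm)
    have hall : ∀ x : PreLoc A, ψ.toFun (mk b x) = F x := by
      intro x
      induction x with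
      | of a => exact hψ a
      | inv => exact hi
      | op f x ih =>
        rw [← op_mk, ψ.map_op]
        exact congrArg (SmoothOps.op f) (funext ih)
    cases ψ with
    | mk g hg =>
      congr 1
      funext x
      induction x using Quotient.inductionOn with
      | h x => exact hall x

end Loc

/-- The `∞`-radical of an ideal `I` of a `C^∞`-ring `A`: the set of all `f ∈ A` for which the
`C^∞`-ring `(A/I){f⁻¹}` is zero. -/
def inftyRadical (I : Ideal A) : Set A :=
  {f | Subsingleton (Loc (Ideal.Quotient.mk I f))}

end CInftyRing

/-!
The statement on nilradicals holds for every ring homomorphism. For `∞`-radicals the point is a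
criterion for `A{b⁻¹} = 0` that mentions only `b` (`CInftyRing.Loc.subsingleton_iff`): there is a
smooth `k : ℝ → ℝ` with no zero outside `{0}` such that `k(b) = 0` in `A`. For the element `f + I`
of `A/I` it reads `k(f) ∈ I` (`CInftyRing.mem_inftyRadical_iff`). Since `φ(k(f)) = k(φ(f))`, the
condition `k(f) ∈ ker φ` says the same as `k(φ(f)) = 0`, and the two `∞`-radicals agree.

If `k(b) = 0`, then `(x y - 1)² + k(x)²` has no zeros on `ℝ²`, hence is a unit, but it vanishes at
`(b, b⁻¹)`; so `A{b⁻¹} = 0`.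

Conversely, suppose `A{b⁻¹} = 0`. There need not be any real points of `A`, so consider all
functions `p : A → ℝ`, with the filter generated by the solution sets of the relations
`g(v₁, …, vₙ) = 0` that hold in `A`. The evaluations `p ↦ p a` define a morphism from `A` to the
ring of germs along this filter, and also along its restriction to `{p | p b ≠ 0}`, where `b`
becomes invertible. By the universal property that last ring is zero, so a single relation of `A`
forces `p b = 0` (`CInftyRing.Loc.eventually_eq_zero_of_subsingleton`). In other words, there is a
smooth `h` on some `ℝⁿ⁺¹`, vanishing at `(b, v₁, …, vₙ)`, whose real zeros all have `x₀ = 0`.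
Finally a function `k(x₀)` that is flat enough at `0` is a multiple of `h`
(`SmoothFn.exists_mul_eq_comp_proj`), so `k(b) = 0`. As `ℝⁿ` is not compact, the flatness comes
from a diagonal choice of coefficients in a series (`exists_pos_contDiff_tsum`).
-/

/-! ### Smooth functions on Euclidean space -/

open Filter in
/-- A sequence of smooth functions can be rescaled by positive constants so that it becomes summable
with smooth sum. The constants are chosen by a diagonal argument: all derivatives of order at most
`j` on the ball of radius `j + 1` are taken into account in the choice of the `j`-th one. -/
theorem exists_pos_contDiff_tsum {E F : Type*} [NormedAddCommGroup E] [NormedSpace ℝ E]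
    [FiniteDimensional ℝ E] [NormedAddCommGroup F] [NormedSpace ℝ F] [CompleteSpace F]
    (f : ℕ → E → F) (hf : ∀ j, ContDiff ℝ ∞ (f j)) :
    ∃ c : ℕ → ℝ, (∀ j, 0 < c j) ∧ (∀ x, Summable fun j => c j • f j x) ∧
      ContDiff ℝ ∞ fun x => ∑' j, c j • f j x := by
  -- The bump functions `χ r`, equal to `1` on the ball of radius `r + 1`, turn bounds on compact
  -- sets into global ones, as the criterion for smoothness of a series requires.
  let χ (r : ℕ) : ContDiffBump (0 : E) := ⟨r + 1, r + 2, by positivity, by linarith⟩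
  have hχf (r j : ℕ) : ContDiff ℝ ∞ fun x => χ r x • f j x := (χ r).contDiff.smul (hf j)
  have hbound (j r m : ℕ) :
      ∃ C, ∀ x, ‖iteratedFDeriv ℝ m (fun x => χ r x • f j x) x‖ ≤ C :=
    ((hχf r j).continuous_iteratedFDeriv
      (by exact_mod_cast le_top)).bounded_above_of_compact_support
      ((χ r).hasCompactSupport.smul_right.iteratedFDeriv m)
  choose M hM using hbound
  let S (j : ℕ) : ℝ := ∑ r ∈ Finset.range (j + 1), ∑ m ∈ Finset.range (j + 1), |M j r m|
  have hS0 (j : ℕ) : 0 ≤ S j :=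
    Finset.sum_nonneg fun _ _ => Finset.sum_nonneg fun _ _ => abs_nonneg _
  have hMS {j r m : ℕ} (hr : r ≤ j) (hm : m ≤ j) : M j r m ≤ S j := by
    refine (le_abs_self _).trans ?_
    refine (Finset.single_le_sum (f := fun m => |M j r m|) (fun _ _ => abs_nonneg _)
      (Finset.mem_range.2 (Nat.lt_succ_of_le hm))).trans ?_
    exact Finset.single_le_sum (f := fun r => ∑ m ∈ Finset.range (j + 1), |M j r m|)
      (fun _ _ => Finset.sum_nonneg fun _ _ => abs_nonneg _)
      (Finset.mem_range.2 (Nat.lt_succ_of_le hr))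
  let c (j : ℕ) : ℝ := (1 / 2) ^ j / (1 + S j)
  have hc (j : ℕ) : 0 < c j := div_pos (by positivity) (by linarith [hS0 j])
  have hder {j r m : ℕ} (hr : r ≤ j) (hm : m ≤ j) (x : E) :
      ‖iteratedFDeriv ℝ m (fun x => c j • χ r x • f j x) x‖ ≤ (1 / 2) ^ j := by
    rw [iteratedFDeriv_const_smul_apply' ((hχf r j).contDiffAt.of_le (by exact_mod_cast le_top)),
      norm_smul, Real.norm_of_nonneg (hc j).le]
    calc c j * _ ≤ c j * (1 + S j) :=
          mul_le_mul_of_nonneg_left (((hM j r m x).trans (hMS hr hm)).trans (by linarith)) (hc j).le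
      _ = (1 / 2) ^ j := div_mul_cancel₀ _ (by linarith [hS0 j])
  have hone {r : ℕ} {x : E} (hx : ‖x‖ < r + 1) : χ r x = 1 :=
    (χ r).one_of_mem_closedBall (by simpa [χ] using hx.le)
  refine ⟨c, hc, fun x => ?_, contDiff_iff_contDiffAt.2 fun x => ?_⟩
  · obtain ⟨r, hr⟩ := exists_nat_ge ‖x‖
    refine Summable.of_norm_bounded_eventually_nat summable_geometric_two ?_
    filter_upwards [eventually_ge_atTop r] with j hj
    have h := hder hj (Nat.zero_le j) x
    rwa [norm_iteratedFDeriv_zero, hone (by linarith), one_smul] at h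
  · obtain ⟨r, hr⟩ := exists_nat_ge ‖x‖
    have hsm : ContDiff ℝ ∞ fun y => ∑' j, c j • χ r y • f j y := by
      refine contDiff_tsum_of_eventually (v := fun _ j => (1 / 2 : ℝ) ^ j)
        (fun j => contDiff_const.smul (hχf r j)) (fun _ _ => summable_geometric_two) fun m _ => ?_
      rw [Nat.cofinite_eq_atTop]
      filter_upwards [eventually_ge_atTop r, eventually_ge_atTop m] with j hr hm y
      exact hder hr hm y
    refine hsm.contDiffAt.congr_of_eventuallyEq ?_
    filter_upwards [continuous_norm.continuousAt.eventually
      (gt_mem_nhds (by linarith : ‖x‖ < r + 1))]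
      with y hy
    simp only [hone hy, one_smul]

/-- If the zeros of `h` lie in the hyperplane `xᵢ = 0`, then some multiple of `h` is a function of
`xᵢ` alone, with no zero except possibly at `0`: a function `k(xᵢ)` so flat at `xᵢ = 0` that
`k(xᵢ) / h` extends smoothly by zero. -/
theorem SmoothFn.exists_mul_eq_comp_proj {n : ℕ} (h : SmoothFn n) (i : Fin n)
    (hz : ∀ x, h.1 x = 0 → x i = 0) :
    ∃ (k : SmoothFn 1) (a : SmoothFn n), (∀ y, k.1 y = 0 → y 0 = 0) ∧
      a * h = k.comp fun _ => SmoothFn.proj i := by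
  -- `ψ j` vanishes near `0`, and every `y ≠ 0` has `ψ j y > 0` for large `j`.
  let ψ (j : ℕ) (y : ℝ) : ℝ := Real.smoothTransition (j * y ^ 2 - 1)
  have hψ (j : ℕ) : ContDiff ℝ ∞ (ψ j) := Real.smoothTransition.contDiff.comp (by fun_prop)
  have hψ0 (j : ℕ) : ψ j 0 = 0 := Real.smoothTransition.zero_of_nonpos (by norm_num)
  have hproj : ContDiff ℝ ∞ fun x : Fin n → ℝ => x i := contDiff_apply ℝ ℝ i
  have hq (j : ℕ) : ContDiff ℝ ∞ fun x : Fin n → ℝ => ψ j (x i) * (h.1 x)⁻¹ := by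
    refine contDiff_iff_contDiffAt.2 fun x => ?_
    by_cases hx : x i = 0
    · refine (contDiffAt_const (c := (0 : ℝ))).congr_of_eventuallyEq ?_
      have hc : Continuous fun x : Fin n → ℝ => (j : ℝ) * x i ^ 2 - 1 := by fun_prop
      filter_upwards [hc.continuousAt.eventually (gt_mem_nhds (by simp [hx] :
        (j : ℝ) * x i ^ 2 - 1 < 0))] with y hy
      rw [show ψ j (y i) = 0 from Real.smoothTransition.zero_of_nonpos hy.le, zero_mul]
    · exact ((hψ j).comp hproj).contDiffAt.mul (h.contDiff.contDiffAt.inv fun h0 => hx (hz x h0))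
  -- The series for the multiplier and for `k` have to use the same coefficients, so they are
  -- treated as one series with values in `ℝ × ℝ`.
  obtain ⟨c, hc, hs, hsm⟩ := exists_pos_contDiff_tsum
    (fun j (x : Fin n → ℝ) => (ψ j (x i) * (h.1 x)⁻¹, ψ j (x i)))
    fun j => (hq j).prodMk ((hψ j).comp hproj)
  have hfst (x : Fin n → ℝ) : (∑' j, c j • (ψ j (x i) * (h.1 x)⁻¹, ψ j (x i))).1 =
      (∑' j, c j * ψ j (x i)) * (h.1 x)⁻¹ := by
    have e := (ContinuousLinearMap.fst ℝ ℝ ℝ).map_tsum (hs x)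
    simpa [← mul_assoc, tsum_mul_right] using e
  have hsnd (x : Fin n → ℝ) : (∑' j, c j • (ψ j (x i) * (h.1 x)⁻¹, ψ j (x i))).2 =
      ∑' j, c j * ψ j (x i) := by
    simpa using (ContinuousLinearMap.snd ℝ ℝ ℝ).map_tsum (hs x)
  have hsum (y : ℝ) : Summable fun j => c j * ψ j y := by
    exact (hs (Function.const _ y)).map (ContinuousLinearMap.snd ℝ ℝ ℝ)
      (ContinuousLinearMap.snd ℝ ℝ ℝ).continuous
  refine ⟨⟨fun y => ∑' j, c j * ψ j (y 0), ?_⟩, ⟨_, hsm.fst⟩, fun y hy => ?_, ?_⟩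
  -- As a function on `ℝ`, `k` is the restriction of `k(xᵢ)` to the diagonal.
  · have he : ContDiff ℝ ∞ fun y : Fin 1 → ℝ => fun _ : Fin n => y 0 := by fun_prop
    have hk := hsm.snd.comp he
    simp only [Function.comp_def, hsnd] at hk
    exact hk
  · by_contra h0
    obtain ⟨j, hj⟩ := exists_nat_gt (1 / y 0 ^ 2)
    have hj' : 1 < j * y 0 ^ 2 := (div_lt_iff₀ (by positivity)).1 hj
    refine ((hsum (y 0)).tsum_pos (fun j => mul_nonneg (hc j).le (Real.smoothTransition.nonneg _)) j
      (mul_pos (hc j) (Real.smoothTransition.pos_of_pos (by linarith)))).ne' hy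
  · ext x
    change (∑' j, c j • (ψ j (x i) * (h.1 x)⁻¹, ψ j (x i))).1 * h.1 x = ∑' j, c j * ψ j (x i)
    rw [hfst]
    by_cases hx : h.1 x = 0
    · simp [hz x hx, hψ0]
    · rw [mul_assoc, inv_mul_cancel₀ hx, mul_one]

/-! ### Germs along the filter of relations -/

namespace CInftyRing

open SmoothOps

theorem evalHom_apply {A : Type u} [CommRing A] [CInftyRing A] {n : ℕ} (v : Fin n → A)
    (f : SmoothFn n) : evalHom v f = op f v := rfl

theorem evalHom_proj {A : Type u} [CommRing A] [CInftyRing A] {n : ℕ} (v : Fin n → A)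
    (i : Fin n) : evalHom v (SmoothFn.proj i) = v i := op_proj i v

/-- The ring of all real functions on a set, with the pointwise smooth operations. -/
instance functions (X : Type u) : CInftyRing (X → ℝ) where
  op f a := fun p => f.1 fun i => a i p
  op_proj _ _ := rfl
  op_comp _ _ _ := rfl
  add_eq _ _ := rfl
  mul_eq _ _ := rfl

variable {A : Type u} [CommRing A] [CInftyRing A]

variable (A) in
/-- The filter on the set of all real functions on `A` generated by the sets of those `p` that
satisfy a relation of `A`: a smooth equation `g(v₁, …, vₙ) = 0` that holds in `A`. It may be the
trivial filter. These sets are closed under finite intersection, because `g² + g'²` vanishes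
exactly where `g` and `g'` do. -/
def relationFilter : Filter (A → ℝ) where
  sets := {Z | ∃ (n : ℕ) (g : SmoothFn n) (v : Fin n → A), op g v = 0 ∧
    ∀ p : A → ℝ, g.1 (p ∘ v) = 0 → p ∈ Z}
  univ_sets := ⟨0, 0, ![], map_zero (evalHom _), fun _ _ => trivial⟩
  sets_of_superset := fun ⟨n, g, v, h0, h⟩ hsub => ⟨n, g, v, h0, fun p hp => hsub (h p hp)⟩
  inter_sets := by
    rintro Z Z' ⟨n, g, v, h0, h⟩ ⟨m, g', v', h0', h'⟩
    refine ⟨n + m, g.comp (fun i => SmoothFn.proj (Fin.castAdd m i)) ^ 2 +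
      g'.comp (fun i => SmoothFn.proj (Fin.natAdd n i)) ^ 2, Fin.append v v', ?_, fun p hp => ?_⟩
    · rw [← evalHom_apply, map_add, map_pow, map_pow, evalHom_apply, evalHom_apply, op_comp,
        op_comp]
      simp [op_proj, h0, h0']
    · have e : g.1 (p ∘ v) ^ 2 + g'.1 (p ∘ v') ^ 2 = 0 := by
        rw [← hp]
        change _ = g.1 (fun i => p (Fin.append v v' (Fin.castAdd m i))) ^ 2 +
          g'.1 (fun i => p (Fin.append v v' (Fin.natAdd n i))) ^ 2
        simp only [Fin.append_left, Fin.append_right]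
        rfl
      constructor
      · exact h p (by nlinarith [sq_nonneg (g'.1 (p ∘ v'))])
      · exact h' p (by nlinarith [sq_nonneg (g.1 (p ∘ v))])

theorem mem_relationFilter {Z : Set (A → ℝ)} : Z ∈ relationFilter A ↔
    ∃ (n : ℕ) (g : SmoothFn n) (v : Fin n → A), op g v = 0 ∧
      ∀ p : A → ℝ, g.1 (p ∘ v) = 0 → p ∈ Z := Iff.rfl

/-- Along the filter of relations, evaluation `p ↦ p a` respects each smooth operation. -/
theorem eventually_relationFilter_op {n : ℕ} (f : SmoothFn n) (a : Fin n → A) :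
    ∀ᶠ p in relationFilter A, p (op f a) = f.1 (p ∘ a) := by
  refine mem_relationFilter.2 ⟨n + 1, SmoothFn.proj 0 - f.comp fun i => SmoothFn.proj i.succ,
    Fin.cons (op f a) a, ?_, fun p hp => ?_⟩
  · rw [← evalHom_apply, map_sub, evalHom_proj, evalHom_apply, op_comp]
    simp [op_proj]
  · exact sub_eq_zero.1 hp

/-- The ideal of the real functions on `X` that vanish eventually along `l`; its quotient is the
ring of germs of functions along `l`. -/
def vanishingIdeal {X : Type u} (l : Filter X) : Ideal (X → ℝ) where
  carrier := {s | ∀ᶠ p in l, s p = 0}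
  zero_mem' := Filter.Eventually.of_forall fun _ => rfl
  add_mem' := fun {s t} (hs : ∀ᶠ p in l, s p = 0) (ht : ∀ᶠ p in l, t p = 0) =>
    show ∀ᶠ p in l, s p + t p = 0 by
      filter_upwards [hs, ht] with p h1 h2
      rw [h1, h2, add_zero]
  smul_mem' := fun s t (ht : ∀ᶠ p in l, t p = 0) => show ∀ᶠ p in l, s p * t p = 0 by
    filter_upwards [ht] with p h
    rw [h, mul_zero]

theorem mem_vanishingIdeal {X : Type u} {l : Filter X} {s : X → ℝ} :
    s ∈ vanishingIdeal l ↔ ∀ᶠ p in l, s p = 0 := Iff.rfl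

/-- The morphism that sends `a` to the germ of the evaluation `p ↦ p a`, along any filter at least
as fine as the filter of relations. -/
noncomputable def toGerms {l : Filter (A → ℝ)} (hl : l ≤ relationFilter A) :
    CInftyHom A (((A → ℝ) → ℝ) ⧸ vanishingIdeal l) where
  toFun a := Ideal.Quotient.mk _ fun p => p a
  map_op f a := by
    rw [quotient_op_mk, Ideal.Quotient.eq, mem_vanishingIdeal]
    filter_upwards [hl (eventually_relationFilter_op f a)] with p hp
    exact sub_eq_zero.2 hp

/-- If `A{b⁻¹} = 0`, then `b = 0` is a consequence, at real points, of some relation in `A`. -/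
theorem Loc.eventually_eq_zero_of_subsingleton (b : A) [hb : Subsingleton (Loc b)] :
    ∀ᶠ p in relationFilter A, p b = 0 := by
  -- `b` becomes invertible in the ring of germs along `l`, which is then zero; so `l` is trivial.
  let l := relationFilter A ⊓ Filter.principal {p : A → ℝ | p b ≠ 0}
  let φ := toGerms (l := l) inf_le_left
  have hu : IsUnit (φ.toFun b) := by
    refine IsUnit.of_mul_eq_one (Ideal.Quotient.mk _ fun p : A → ℝ => (p b)⁻¹) ?_
    change Ideal.Quotient.mk _ (fun p : A → ℝ => p b) * _ = _
    rw [← map_mul, ← map_one (Ideal.Quotient.mk _), Ideal.Quotient.eq, mem_vanishingIdeal]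
    filter_upwards [Filter.mem_inf_of_right (Filter.mem_principal_self _)] with p hp
    exact sub_eq_zero.2 (mul_inv_cancel₀ hp)
  obtain ⟨ψ, -, -⟩ := Loc.existsUnique_lift b φ hu
  have h10 : (Ideal.Quotient.mk (vanishingIdeal l) 1) = 0 := by
    rw [map_one, ← map_one ψ.toRingHom, Subsingleton.elim (1 : Loc b) 0, map_zero]
  rw [Ideal.Quotient.eq_zero_iff_mem, mem_vanishingIdeal, Filter.eventually_inf_principal] at h10
  filter_upwards [h10] with p hp
  by_contra h0
  exact one_ne_zero (hp h0)

/-- A relation `g(v) = 0` can be strengthened so that its real solutions are values `p ∘ v` of a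
real function on `A`. This matters when `v` has repeated entries: the equations `xᵢ = xⱼ` for
`vᵢ = vⱼ` are added. -/
theorem exists_op_eq_zero_and_factors {n : ℕ} (g : SmoothFn n)
    (v : Fin n → A) (hg : op g v = 0) :
    ∃ h : SmoothFn n, op h v = 0 ∧ ∀ x, h.1 x = 0 → g.1 x = 0 ∧ ∃ p : A → ℝ, x = p ∘ v := by
  classical
  let d (i j : Fin n) : SmoothFn n :=
    if v i = v j then (SmoothFn.proj i - SmoothFn.proj j) ^ 2 else 0
  have hd (i j : Fin n) (x : Fin n → ℝ) :
      (d i j).1 x = if v i = v j then (x i - x j) ^ 2 else 0 := by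
    by_cases hij : v i = v j
    · simp only [d, if_pos hij]; rfl
    · simp only [d, if_neg hij]; rfl
  refine ⟨g ^ 2 + ∑ i, ∑ j, d i j, ?_, fun x hx => ?_⟩
  · rw [← evalHom_apply]
    simp only [map_add, map_pow, map_sum, evalHom_apply, hg]
    rw [zero_pow two_ne_zero, zero_add]
    refine Finset.sum_eq_zero fun i _ => Finset.sum_eq_zero fun j _ => ?_
    rw [← evalHom_apply]
    by_cases hij : v i = v j
    · simp only [d, if_pos hij, map_pow, map_sub, evalHom_proj, hij, sub_self]
      exact zero_pow two_ne_zero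
    · simp only [d, if_neg hij, map_zero]
  · have hx' : g.1 x ^ 2 + ∑ i, ∑ j, (d i j).1 x = 0 := by
      rw [← hx]
      simp
    have hd0 (i j : Fin n) : 0 ≤ (d i j).1 x := by
      rw [hd]; split_ifs <;> positivity
    have hs0 (i : Fin n) : 0 ≤ ∑ j, (d i j).1 x := Finset.sum_nonneg fun j _ => hd0 i j
    have hsum := (add_eq_zero_iff_of_nonneg (sq_nonneg _)
      (Finset.sum_nonneg fun i _ => hs0 i)).1 hx'
    refine ⟨pow_eq_zero_iff two_ne_zero |>.1 hsum.1, Function.extend v x fun _ => 0, ?_⟩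
    have hf : Function.FactorsThrough x v := fun i j hij => by
      have h1 := (Finset.sum_eq_zero_iff_of_nonneg fun i _ => hs0 i).1 hsum.2 i (Finset.mem_univ _)
      have h2 := (Finset.sum_eq_zero_iff_of_nonneg fun j _ => hd0 i j).1 h1 j (Finset.mem_univ _)
      rw [hd, if_pos hij] at h2
      exact sub_eq_zero.1 (pow_eq_zero_iff two_ne_zero |>.1 h2)
    exact (hf.extend_comp _).symm

/-! ### When a localization is zero -/

/-- `A{b⁻¹}` is zero exactly when `b` is a zero of a smooth function on `ℝ` that has no real zero
except possibly `0`. The criterion involves no element of `A` besides `b`. -/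
theorem Loc.subsingleton_iff (b : A) : Subsingleton (Loc b) ↔
    ∃ k : SmoothFn 1, (∀ y, k.1 y = 0 → y 0 = 0) ∧ op k ![b] = 0 := by
  constructor
  · intro hb
    obtain ⟨n, g, v, hg, hz⟩ := mem_relationFilter.1 (eventually_eq_zero_of_subsingleton b)
    -- `b` is added as the coordinate `x₀`, so that the relation forces `x₀ = 0`.
    obtain ⟨h, h0, hh⟩ := exists_op_eq_zero_and_factors
      (g.comp fun i => SmoothFn.proj i.succ) (Fin.cons b v : Fin (n + 1) → A)
      (by rw [op_comp]; simpa [op_proj] using hg)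
    obtain ⟨k, a, hk, e⟩ := h.exists_mul_eq_comp_proj 0 fun x hx => by
      obtain ⟨hgx, p, rfl⟩ := hh x hx
      exact hz p hgx
    refine ⟨k, hk, ?_⟩
    have e2 := congrArg (evalHom (Fin.cons b v : Fin (n + 1) → A)) e
    rw [map_mul, evalHom_apply, evalHom_apply, evalHom_apply, h0, mul_zero, op_comp] at e2
    rw [e2]
    congr 1
    funext i
    fin_cases i
    simp [op_proj]
  · rintro ⟨k, hk, hkb⟩
    have hk' : op k ![(Loc.of b).toFun b] = 0 := by
      have e := (Loc.of b).map_op k ![b]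
      rw [hkb] at e
      have hv : ![(Loc.of b).toFun b] = fun i => (Loc.of b).toFun (![b] i) := by
        funext i; fin_cases i; rfl
      rw [hv, ← e]
      exact map_zero (Loc.of b).toRingHom
    -- `s` has no real zero, so it is a unit, yet it vanishes at `(b, b⁻¹)`.
    let s : SmoothFn 2 := (SmoothFn.proj 0 * SmoothFn.proj 1 - 1) ^ 2 +
      (k.comp fun _ => SmoothFn.proj 0) ^ 2
    have hs (x : Fin 2 → ℝ) : s.1 x = (x 0 * x 1 - 1) ^ 2 + k.1 (fun _ => x 0) ^ 2 := rfl
    have hs0 (x : Fin 2 → ℝ) : s.1 x ≠ 0 := fun h0 => by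
      rw [hs, add_eq_zero_iff_of_nonneg (sq_nonneg _) (sq_nonneg _)] at h0
      have h1 := hk _ (pow_eq_zero_iff two_ne_zero |>.1 h0.2)
      simp [h1] at h0
    let t : SmoothFn 2 := ⟨fun x => (s.1 x)⁻¹, s.contDiff.inv hs0⟩
    have hst : s * t = 1 := by
      ext x
      exact mul_inv_cancel₀ (hs0 x)
    let w : Fin 2 → Loc b := ![(Loc.of b).toFun b, Loc.inv b]
    have hsw : evalHom w s = 0 := by
      have h2 : evalHom w (k.comp fun _ => SmoothFn.proj 0) = 0 := by
        rw [evalHom_apply, op_comp, ← hk']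
        congr 1
        funext i
        fin_cases i
        simp [op_proj, w]
      simp only [s, map_add, map_pow, map_sub, map_mul, map_one, h2, evalHom_proj]
      simp [w, Loc.mul_inv_eq_one]
    have h01 : (0 : Loc b) = 1 := by
      simpa only [map_mul, hsw, zero_mul, map_one] using congrArg (evalHom w) hst
    exact subsingleton_of_zero_eq_one h01

theorem mem_inftyRadical_iff (I : Ideal A) (f : A) : f ∈ inftyRadical I ↔
    ∃ k : SmoothFn 1, (∀ y, k.1 y = 0 → y 0 = 0) ∧ op k ![f] ∈ I := by
  have hv : ![Ideal.Quotient.mk I f] = fun i => Ideal.Quotient.mk I (![f] i) := by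
    funext i; fin_cases i; rfl
  refine (Loc.subsingleton_iff _).trans ?_
  simp only [hv, quotient_op_mk, Ideal.Quotient.eq_zero_iff_mem]

end CInftyRing

theorem mainTheorem1 {A₁ : Type u} {A₂ : Type v} [CommRing A₁] [CInftyRing A₁]
    [CommRing A₂] [CInftyRing A₂] (φ : CInftyHom A₁ A₂) :
    Ideal.comap φ.toRingHom (Ideal.radical ⊥) = Ideal.radical (RingHom.ker φ.toRingHom) ∧
    φ.toFun ⁻¹' CInftyRing.inftyRadical (⊥ : Ideal A₂) =
      CInftyRing.inftyRadical (RingHom.ker φ.toRingHom) := by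
  refine ⟨Ideal.comap_radical _ _, Set.ext fun f => ?_⟩
  rw [Set.mem_preimage, CInftyRing.mem_inftyRadical_iff, CInftyRing.mem_inftyRadical_iff]
  have hv : ![φ.toFun f] = fun i => φ.toFun (![f] i) := by
    funext i; fin_cases i; rfl
  simp only [hv, ← φ.map_op]
  rfl
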